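/- For $d\in\{1,2\}$, a $d$-dimensional cellular automaton (CA) consists of a finite nonempty set of states $\mathcal A$, a finite neighborhood $U\subset\mathbb Z^d$ and a local rule $f:\mathcal A^{U}\to\mathcal A$; its global map $F:\mathcal A^{\mathbb Z^d}\to\mathcal A^{\mathbb Z^d}$ is $F(x)_m=f\big((x_{m+u})_{u\in U}\big)$, and its radius is $r=\max\{\|u\|_\infty:u\in U\}$ ($r=0$ if $U=\emptyset$). Let $d_C(x,y)=2^{-\min\{\|i\|_\infty\,:\,x_i\neq y_i\}}$ for $x\ne y$, and $d_C(x,x)=0$. A real $\varepsilon>0$ is an admissible sensitivity constant of the CA if for all $\delta>0$ and all $x\in\mathcal A^{\mathbb Z^d}$ there are $y\in\mathcal A^{\mathbb Z^d}$ and $n\in\mathbb N$ with $d_C(x,y)<\delta$ and $d_C(F^n(x),F^n(y))>\varepsilon$. The CA is sensitive if it has an admissible sensitivity constant, and its maximal admissible sensitivity constant is then the supremum of all of them. (1) The maximal admissible sensitivity constant of sensitive 2-dimensional CA cannot be recursively bounded below in the number of states and the size of the neighborhood (where the bound may depend on both the cardinality and the radius of the neighborhood): for every recursive function $g:\mathbb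 N^3\to\mathbb Q_{>0}$, there is a sensitive 2-dimensional CA with state set $\mathcal A$, neighborhood $U$ and radius $r$ whose maximal admissible sensitivity constant is smaller than $g(|\mathcal A|,|U|,r)$. (2) In contrast, for every sensitive 1-dimensional CA of radius $r$, $2^{-2r}$ is an admissible sensitivity constant. -/

import Mathlib

/-- The sup norm `‖i‖_∞` of a point of `ℤ^d`, as a natural number. -/
def supNorm {d : ℕ} (i : Fin d → ℤ) : ℕ :=
  Finset.univ.sup fun j => (i j).natAbs

/-- Configurations: the space `A^(ℤ^d)`. -/
abbrev Config (d : ℕ) (A : Type) : Type := (Fin d → ℤ) → A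

open Classical in
/-- The metric `2 ^ (-min {‖i‖_∞ : x i ≠ y i})`, which is `0` when `x = y`.
The infimum of a nonempty set of natural numbers is its minimum. -/
noncomputable def configDist {d : ℕ} {A : Type} (x y : Config d A) : ℝ :=
  if x = y then 0 else (2 : ℝ)⁻¹ ^ sInf {n : ℕ | ∃ i, x i ≠ y i ∧ supNorm i = n}

/-- A `d`-dimensional cellular automaton with state set `A`: a finite neighborhood and a
local rule. -/
structure CellularAutomaton (d : ℕ) (A : Type) where
  nbhd : Finset (Fin d → ℤ)
  rule : (nbhd → A) → A

namespace CellularAutomaton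

/-- The global map `F(x)_m = f((x_(m+u))_(u ∈ U))`. -/
def globalMap {d : ℕ} {A : Type} (F : CellularAutomaton d A) (x : Config d A) : Config d A :=
  fun m => F.rule fun u => x (m + u.1)

/-- The radius: the largest sup norm of an element of the neighborhood. -/
def radius {d : ℕ} {A : Type} (F : CellularAutomaton d A) : ℕ :=
  F.nbhd.sup supNorm

/-- `ε` is an admissible sensitivity constant of `F`. -/
def IsSensitivityConstant {d : ℕ} {A : Type} (F : CellularAutomaton d A) (ε : ℝ) : Prop :=
  0 < ε ∧ ∀ δ : ℝ, 0 < δ → ∀ x : Config d A, ∃ (y : Config d A) (n : ℕ),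
    configDist x y < δ ∧ ε < configDist (F.globalMap^[n] x) (F.globalMap^[n] y)

/-- Sensitivity to initial conditions. -/
def Sensitive {d : ℕ} {A : Type} (F : CellularAutomaton d A) : Prop :=
  ∃ ε : ℝ, F.IsSensitivityConstant ε

/-- The maximal admissible sensitivity constant: the supremum of the admissible ones. -/
noncomputable def sensitivityConstant {d : ℕ} {A : Type} (F : CellularAutomaton d A) : ℝ :=
  sSup {ε : ℝ | F.IsSensitivityConstant ε}

/-- For a sensitive automaton with at least one state, the supremum above is a genuine one. -/
theorem isLUB_sensitivityConstant {d : ℕ} {A : Type} [Nonempty A] (F : CellularAutomaton d A)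
    (hF : F.Sensitive) :
    IsLUB {ε : ℝ | F.IsSensitivityConstant ε} F.sensitivityConstant := by
  refine isLUB_csSup hF ⟨1, ?_⟩
  rintro ε ⟨-, h⟩
  obtain ⟨y, n, -, hn⟩ := h 1 one_pos (fun _ => Classical.arbitrary A)
  refine hn.le.trans ?_
  unfold configDist
  split_ifs
  · exact zero_le_one
  · exact pow_le_one₀ (by norm_num) (by norm_num)

end CellularAutomaton

/-!
**One dimension.** If `2 ^ (-2 * r)` is not admissible, then some word determines forever the cells
at distance less than `2 * r` from its centre, whatever surrounds it. These are at least `r`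
consecutive cells, so that no information crosses them. In a periodic repetition of the word every
interval between two copies is thus protected (`not_sensitive_of_blocking`), and the automaton is
not sensitive.

**Two dimensions.** In the plane, a protected region has to be enclosed on all sides, and a region
that is allowed to exist only if it is filled in by a correct tiling can be kept from being large,
while its largest possible size is as hard to bound as the running time of a Turing machine.

The states of the automaton are letters and tiles. A tile disappears, leaving a letter, once its
surroundings violate a local constraint; letters never become tiles. Among the constraints are the
diagonal conditions, by which the remaining tiles form rectangles that do not touch each other,
even at a corner. Each letter is copied from the cell above or, just below a rectangle, from the
cell to the right; a cell without tile thus receives its letters along a path that goes around the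
rectangles and comes from arbitrarily far away
(`exists_iterate_eq_of_tiles_eq_none`). Hence the automaton is sensitive if the correct finite
rectangles are bounded in height (`sensitive_tileAutomaton`). On the other hand a correct rectangle
stays in place whatever happens far from it, and bounds the sensitivity constant from above
(`sensitivityConstant_tileAutomaton_le`).

The remaining constraints force each rectangle to contain the space-time diagram of a Turing
machine `M` started on an input `l`, with its head inside the rectangle and not halting. If `M`
halts after `t` steps, no rectangle has more than `t` rows (`configAt_ne_none_of_column`), while there
are correct rectangles of about that size (`exists_isValidTiling`). It remains to let `M` compute a
number with more digits than the given recursive function allows for (`exists_late_halting`): the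
input `k` of `M` is the number of states that the automaton is going to have, it is forced onto the
bottom row by a number of tiles logarithmic in `k`, and additional letters bring the number of
states to exactly `k`. The neighbourhood is the `3 × 3` square in all cases.
-/

/-! ### The metric on configurations -/

theorem natAbs_le_supNorm {d : ℕ} (i : Fin d → ℤ) (j : Fin d) : (i j).natAbs ≤ supNorm i :=
  Finset.le_sup (f := fun j => (i j).natAbs) (Finset.mem_univ j)

theorem supNorm_le_iff {d : ℕ} {i : Fin d → ℤ} {n : ℕ} :
    supNorm i ≤ n ↔ ∀ j, (i j).natAbs ≤ n := by
  simp [supNorm, Finset.sup_le_iff]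

theorem configDist_le_of_agree {d : ℕ} {A : Type} {x y : Config d A} {n : ℕ}
    (h : ∀ i, supNorm i < n → x i = y i) : configDist x y ≤ (2 : ℝ)⁻¹ ^ n := by
  unfold configDist
  split_ifs with hxy
  · positivity
  · refine pow_le_pow_of_le_one (by norm_num) (by norm_num) (le_csInf ?_ ?_)
    · obtain ⟨i, hi⟩ := Function.ne_iff.1 hxy
      exact ⟨_, i, hi, rfl⟩
    · rintro _ ⟨i, hi, rfl⟩
      exact not_lt.1 fun hlt => hi (h i hlt)

theorem le_configDist_of_ne {d : ℕ} {A : Type} {x y : Config d A} {n : ℕ} {i : Fin d → ℤ}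
    (hi : supNorm i ≤ n) (h : x i ≠ y i) : (2 : ℝ)⁻¹ ^ n ≤ configDist x y := by
  unfold configDist
  rw [if_neg fun hxy => h (congrFun hxy i)]
  refine pow_le_pow_of_le_one (by norm_num) (by norm_num) (le_trans (Nat.sInf_le ?_) hi)
  exact ⟨i, h, rfl⟩

theorem exists_half_pow_lt {δ : ℝ} (hδ : 0 < δ) : ∃ n : ℕ, (2 : ℝ)⁻¹ ^ n < δ :=
  exists_pow_lt_of_lt_one hδ (by norm_num)

/-! ### One-dimensional automata -/

namespace CellularAutomaton

/-- Global maps commute with translations. -/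
theorem iterate_globalMap_translate {d : ℕ} {A : Type} (F : CellularAutomaton d A)
    (v : Fin d → ℤ) (n : ℕ) (x : Config d A) :
    F.globalMap^[n] (fun i => x (v + i)) = fun i => (F.globalMap^[n] x) (v + i) := by
  have h : Function.Semiconj (fun (x : Config d A) i => x (v + i)) F.globalMap F.globalMap := by
    intro x
    funext i
    simp only [globalMap, add_assoc]
  exact ((h.iterate_right n).eq x).symm

/-- A word of length `2 * k + 1` whose presence determines forever all the cells at distance
less than `2 * r` from its centre, where `r` is the radius, can be repeated periodically, and
then two copies of it isolate the cells between them: the automaton is not sensitive. -/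
theorem not_sensitive_of_blocking {A : Type} (F : CellularAutomaton 1 A) (k : ℕ) (x : Config 1 A)
    (h : ∀ (y : Config 1 A) (n : ℕ), (∀ i, supNorm i ≤ k → x i = y i) →
      ∀ i, supNorm i < 2 * F.radius → (F.globalMap^[n] x) i = (F.globalMap^[n] y) i) :
    ¬ F.Sensitive := by
  rintro ⟨ε, hε, hs⟩
  have norm_lt : ∀ (a : ℤ) (n : ℕ), supNorm (fun _ : Fin 1 => a) < n ↔ |a| < n := by
    intro a n
    simp only [supNorm, Finset.univ_unique, Finset.sup_singleton]
    rw [abs_lt]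
    omega
  have blocked : ∀ (p : ℤ) (y z : Config 1 A),
      (∀ a : ℤ, |a| ≤ k → y (fun _ => p + a) = x fun _ => a) →
      (∀ a : ℤ, |a| ≤ k → z (fun _ => p + a) = x fun _ => a) →
      ∀ (n : ℕ) (a : ℤ), |a| < 2 * F.radius →
        (F.globalMap^[n] y) (fun _ => p + a) = (F.globalMap^[n] z) fun _ => p + a := by
    have one : ∀ (p : ℤ) (y : Config 1 A),
        (∀ a : ℤ, |a| ≤ k → y (fun _ => p + a) = x fun _ => a) →
        ∀ (n : ℕ) (a : ℤ), |a| < 2 * F.radius →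
          (F.globalMap^[n] x) (fun _ => a) = (F.globalMap^[n] y) fun _ => p + a := by
      intro p y hy n a ha
      have := h (fun i => y ((fun _ => p) + i)) n (fun i hi => by
        have e : i = fun _ => i 0 := by funext j; rw [Subsingleton.elim j 0]
        rw [e] at hi ⊢
        have := (norm_lt (i 0) (k + 1)).1 (by omega)
        exact (hy (i 0) (by push_cast at this; exact Int.lt_add_one_iff.1 this)).symm) (fun _ => a)
        ((norm_lt _ _).2 (by push_cast; exact ha))
      rw [iterate_globalMap_translate] at this
      exact this
    intro p y z hy hz n a ha
    rw [← one p y hy n a ha, one p z hz n a ha]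
  obtain ⟨s, hs'⟩ := exists_half_pow_lt hε
  set N : ℕ := (2 * k + 1) * s with hN
  let z : Config 1 A := fun i => x fun _ => (i 0 + k) % (2 * k + 1) - k
  have hz : ∀ (e : ℤ) (a : ℤ), |a| ≤ k → z (fun _ => (2 * k + 1) * e + a) = x fun _ => a := by
    intro e a ha
    show x _ = _
    congr 1
    funext _
    rw [add_assoc, Int.mul_add_emod_self_left, Int.emod_eq_of_lt]
    all_goals (rw [abs_le] at ha; omega)
  obtain ⟨y, n, hy, hn⟩ := hs ((2 : ℝ)⁻¹ ^ (N + k)) (by positivity) z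
  have hzy : ∀ a : ℤ, |a| ≤ N + k → z (fun _ => a) = y fun _ => a := by
    intro a ha
    by_contra hne
    refine hy.not_ge (le_configDist_of_ne (Nat.lt_succ_iff.1 ((norm_lt a (N + k + 1)).2 ?_)) hne)
    push_cast
    omega
  have hyz : ∀ e : ℤ, |e| ≤ s → ∀ a : ℤ, |a| ≤ k →
      y (fun _ => (2 * k + 1) * e + a) = x fun _ => a := by
    intro e he a ha
    rw [← hzy, hz e a ha]
    have h1 : |(2 * (k : ℤ) + 1) * e| ≤ N := by
      rw [abs_mul, hN, abs_of_nonneg (by omega : (0 : ℤ) ≤ 2 * k + 1)]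
      push_cast
      gcongr
    exact (abs_add_le _ _).trans (add_le_add h1 ha)
  have agree : ∀ (n : ℕ) (a : ℤ), |a| ≤ N →
      (F.globalMap^[n] z) (fun _ => a) = (F.globalMap^[n] y) fun _ => a := by
    intro n
    induction n with
    | zero => exact fun a ha => hzy a (by omega)
    | succ n ih =>
      intro a ha
      rw [Function.iterate_succ_apply', Function.iterate_succ_apply']
      show F.rule _ = F.rule _
      congr 1
      funext ⟨u, hu⟩
      have hur : (u 0).natAbs ≤ F.radius :=
        (natAbs_le_supNorm u 0).trans (Finset.le_sup (f := supNorm) hu)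
      have e : (fun _ => a) + u = fun _ : Fin 1 => a + u 0 := by
        funext j; rw [Subsingleton.elim j 0]; rfl
      show (F.globalMap^[n] z) ((fun _ => a) + u) = (F.globalMap^[n] y) ((fun _ => a) + u)
      rw [e]
      -- A neighbour outside `[-N, N]` lies at distance at most `r` from `N` or `-N`.
      have key : ∀ e : ℤ, |e| ≤ s → |a + u 0 - (2 * k + 1) * e| < 2 * F.radius →
          (F.globalMap^[n] z) (fun _ => a + u 0) = (F.globalMap^[n] y) fun _ => a + u 0 := by
        intro e he hd
        have := blocked ((2 * k + 1) * e) z y (hz e) (hyz e he) n (a + u 0 - (2 * k + 1) * e) hd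
        simpa using this
      have hNz : (N : ℤ) = (2 * k + 1) * s := by rw [hN]; push_cast; ring
      by_cases hin : |a + u 0| ≤ N
      · exact ih _ hin
      · rcases lt_or_ge 0 (a + u 0) with hpos | hneg
        · refine key s (by simp) ?_
          rw [← hNz, abs_lt]
          rw [abs_le] at ha hin
          omega
        · refine key (-s) (by simp) ?_
          rw [mul_neg, ← hNz, abs_lt]
          rw [abs_le] at ha hin
          omega
  refine hn.not_ge ((configDist_le_of_agree (n := N) ?_).trans ?_)
  · intro i hi
    have e : i = fun _ => i 0 := by funext j; rw [Subsingleton.elim j 0]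
    rw [e] at hi ⊢
    exact agree n _ ((norm_lt _ _).1 hi).le
  · refine le_trans (pow_le_pow_of_le_one (by norm_num) (by norm_num) ?_) hs'.le
    rw [hN]
    exact Nat.le_mul_of_pos_left _ (by omega)

theorem isSensitivityConstant_of_sensitive {A : Type} (F : CellularAutomaton 1 A)
    (hF : F.Sensitive) : F.IsSensitivityConstant ((2 : ℝ)⁻¹ ^ (2 * F.radius)) := by
  refine ⟨by positivity, ?_⟩
  by_contra! hcon
  obtain ⟨δ, hδ, x, hx⟩ := hcon
  obtain ⟨k, hk⟩ := exists_half_pow_lt hδ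
  refine not_sensitive_of_blocking F k x (fun y n hy i hi => ?_) hF
  by_contra hne
  have hd : configDist x y < δ :=
    (configDist_le_of_agree fun i hi => hy i hi.le).trans_lt hk
  have h1 := (le_configDist_of_ne (Nat.le_sub_one_of_lt hi) hne).trans (hx y n hd)
  have h2 : (2 : ℝ)⁻¹ ^ (2 * F.radius) < (2 : ℝ)⁻¹ ^ (2 * F.radius - 1) :=
    pow_lt_pow_right_of_lt_one₀ (by norm_num) (by norm_num) (by omega)
  exact h1.not_gt h2

end CellularAutomaton

/-! ### Planar automata given by a rule on the plane -/

/-- A planar configuration as a function of two integer coordinates. -/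
def toPlane {A : Type} (x : Config 2 A) : ℤ → ℤ → A := fun i j => x ![i, j]

/-- The `3 × 3` square around the origin. -/
noncomputable def squareNbhd : Finset (Fin 2 → ℤ) := Fintype.piFinset fun _ => Finset.Icc (-1) 1

theorem mem_squareNbhd {a b : ℤ} :
    ![a, b] ∈ squareNbhd ↔ a.natAbs ≤ 1 ∧ b.natAbs ≤ 1 := by
  simp only [squareNbhd, Fintype.mem_piFinset, Finset.mem_Icc, Fin.forall_fin_two,
    Matrix.cons_val_zero, Matrix.cons_val_one]
  omega

theorem supNorm_pair_le {a b : ℤ} {n : ℕ} :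
    supNorm ![a, b] ≤ n ↔ a.natAbs ≤ n ∧ b.natAbs ≤ n := by
  simp [supNorm_le_iff, Fin.forall_fin_two]

/-- The rule `G`, which sees the whole plane around the current cell, applied everywhere. -/
def planeStep {A : Type} (G : (ℤ → ℤ → A) → A) (X : ℤ → ℤ → A) : ℤ → ℤ → A :=
  fun i j => G fun a b => X (i + a) (j + b)

/-- The rule `G` sees only the `3 × 3` square around the current cell. -/
def IsNearestNeighbor {A B : Type*} (G : (ℤ → ℤ → A) → B) : Prop :=
  ∀ X Y : ℤ → ℤ → A, (∀ a b : ℤ, a.natAbs ≤ 1 → b.natAbs ≤ 1 → X a b = Y a b) → G X = G Y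

/-- The cellular automaton of a nearest-neighbour rule `G`: the cells out of sight, which `G`
ignores, are shown to it in the state `d`. -/
noncomputable def CellularAutomaton.ofPlaneRule {A : Type} (G : (ℤ → ℤ → A) → A) (d : A) :
    CellularAutomaton 2 A where
  nbhd := squareNbhd
  rule w := G fun a b => if h : ![a, b] ∈ squareNbhd then w ⟨![a, b], h⟩ else d

theorem toPlane_globalMap {A : Type} {G : (ℤ → ℤ → A) → A} (hG : IsNearestNeighbor G) (d : A)
    (x : Config 2 A) :
    toPlane ((CellularAutomaton.ofPlaneRule G d).globalMap x) = planeStep G (toPlane x) := by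
  funext i j
  refine hG _ _ fun a b ha hb => ?_
  show (if h : ![a, b] ∈ squareNbhd then x (![i, j] + ![a, b]) else d) = _
  rw [dif_pos (mem_squareNbhd.2 ⟨ha, hb⟩)]
  simp [toPlane]

theorem toPlane_iterate_globalMap {A : Type} {G : (ℤ → ℤ → A) → A} (hG : IsNearestNeighbor G)
    (d : A) (n : ℕ) (x : Config 2 A) :
    toPlane ((CellularAutomaton.ofPlaneRule G d).globalMap^[n] x) =
      (planeStep G)^[n] (toPlane x) :=
  (Function.Semiconj.iterate_right (f := toPlane) (toPlane_globalMap hG d) n).eq x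

theorem exists_eq_toPlane {A : Type} (X : ℤ → ℤ → A) : ∃ x : Config 2 A, toPlane x = X :=
  ⟨fun i => X (i 0) (i 1), rfl⟩

theorem eq_pair (i : Fin 2 → ℤ) : i = ![i 0, i 1] := by
  funext j
  fin_cases j <;> rfl

/-! ### Erosion of tilings -/

section Tiles

variable {K T : Type}

/-- The tiles of a plane of letters (`Sum.inl`) and tiles (`Sum.inr`). -/
def tiles (X : ℤ → ℤ → K ⊕ T) : ℤ → ℤ → Option T := fun i j => (X i j).getRight?

/-- The plane `P` as seen from the cell `(i, j)`. -/
def around {B : Type*} (P : ℤ → ℤ → B) (i j : ℤ) : ℤ → ℤ → B := fun a b => P (i + a) (j + b)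

/-- `P` is everywhere correct for the local constraint `V`. -/
def IsValidTiling (V : (ℤ → ℤ → Option T) → Prop) (P : ℤ → ℤ → Option T) : Prop :=
  ∀ i j, P i j ≠ none → V (around P i j)

open Classical in
/-- A tile is removed when its surroundings violate the constraint `V`. -/
noncomputable def erode (V : (ℤ → ℤ → Option T) → Prop) (P : ℤ → ℤ → Option T) :
    ℤ → ℤ → Option T :=
  fun i j => if V (around P i j) then P i j else none

open Classical in
/-- A tile stays for as long as its surroundings satisfy `V`, and is then replaced by the
letter `d`. A letter is replaced by the letter above or, if a tile is above, by the letter to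
the right. -/
noncomputable def tileRule (V : (ℤ → ℤ → Option T) → Prop) (d : K) (X : ℤ → ℤ → K ⊕ T) : K ⊕ T :=
  match X 0 0 with
  | .inr t => if V (tiles X) then .inr t else .inl d
  | .inl _ =>
    match X 0 1 with
    | .inl k => .inl k
    | .inr _ =>
      match X 1 0 with
      | .inl k => .inl k
      | .inr _ => .inl d

variable {V : (ℤ → ℤ → Option T) → Prop} {d : K}

theorem isNearestNeighbor_tileRule (hV : IsNearestNeighbor V) (d : K) :
    IsNearestNeighbor (tileRule V d) := by
  intro X Y h
  have hVXY : V (tiles X) = V (tiles Y) :=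
    hV _ _ fun a b ha hb => by simp only [tiles, h a b ha hb]
  unfold tileRule
  rw [h 0 0 (by decide) (by decide), h 0 1 (by decide) (by decide), h 1 0 (by decide) (by decide),
    hVXY]

theorem tiles_planeStep (X : ℤ → ℤ → K ⊕ T) :
    tiles (planeStep (tileRule V d) X) = erode V (tiles X) := by
  funext i j
  have e : tiles (fun a b => X (i + a) (j + b)) = around (tiles X) i j := rfl
  rw [tiles, planeStep, tileRule, erode, e]
  simp only [add_zero, tiles]
  cases hX : X i j with
  | inr t => by_cases hV : V (around (tiles X) i j) <;> simp [hV]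
  | inl k => cases X i (j + 1) <;> cases X (i + 1) j <;> simp

theorem tiles_iterate_planeStep (n : ℕ) (X : ℤ → ℤ → K ⊕ T) :
    tiles ((planeStep (tileRule V d))^[n] X) = (erode V)^[n] (tiles X) :=
  (Function.Semiconj.iterate_right (f := tiles) tiles_planeStep n).eq X

theorem eq_inl_of_tiles_eq_none {X : ℤ → ℤ → K ⊕ T} {i j : ℤ} (h : tiles X i j = none) :
    ∃ k, X i j = .inl k := by
  cases hX : X i j with
  | inl k => exact ⟨k, rfl⟩
  | inr t => simp [tiles, hX] at h

theorem planeStep_of_up {X : ℤ → ℤ → K ⊕ T} {i j : ℤ} {k : K} (h : tiles X i j = none)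
    (hk : X i (j + 1) = .inl k) : planeStep (tileRule V d) X i j = .inl k := by
  obtain ⟨l, hl⟩ := eq_inl_of_tiles_eq_none h
  simp [planeStep, tileRule, hl, hk]

theorem planeStep_of_right {X : ℤ → ℤ → K ⊕ T} {i j : ℤ} {k : K} (h : tiles X i j = none)
    (hup : tiles X i (j + 1) ≠ none) (hk : X (i + 1) j = .inl k) :
    planeStep (tileRule V d) X i j = .inl k := by
  obtain ⟨l, hl⟩ := eq_inl_of_tiles_eq_none h
  cases hu : X i (j + 1) with
  | inl m => simp [tiles, hu] at hup
  | inr t => simp [planeStep, tileRule, hl, hk, hu]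

theorem erode_eq_none {P : ℤ → ℤ → Option T} {i j : ℤ} (h : P i j = none) :
    erode V P i j = none := by
  simp [erode, h]

theorem iterate_erode_eq_none {P : ℤ → ℤ → Option T} {i j : ℤ} (h : P i j = none) (n : ℕ) :
    (erode V)^[n] P i j = none := by
  induction n with
  | zero => exact h
  | succ n ih => rw [Function.iterate_succ_apply']; exact erode_eq_none ih

theorem isValidTiling_of_erode_eq {P : ℤ → ℤ → Option T} (h : erode V P = P) :
    IsValidTiling V P := by
  intro i j hij
  by_contra hV
  exact hij (by rw [← h, erode, if_neg hV])

/-- `P` has no tile outside the square of radius `M`. -/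
def IsBoundedTiling (M : ℕ) (P : ℤ → ℤ → Option T) : Prop :=
  ∀ i j, P i j ≠ none → i.natAbs ≤ M ∧ j.natAbs ≤ M

/-- The erosion of finitely many tiles comes to an end. -/
theorem exists_erode_iterate_eq {M : ℕ} {P : ℤ → ℤ → Option T} (hP : IsBoundedTiling M P) :
    ∃ t, erode V ((erode V)^[t] P) = (erode V)^[t] P := by
  let D : ℕ → Set (ℤ × ℤ) := fun t => {z | (erode V)^[t] P z.1 z.2 ≠ none}
  have hfin : ∀ t, (D t).Finite := by
    intro t
    refine ((Set.finite_Icc (-(M : ℤ)) M).prod (Set.finite_Icc (-(M : ℤ)) M)).subset ?_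
    intro z hz
    have := hP z.1 z.2 fun h => hz (iterate_erode_eq_none h t)
    simp only [Set.mem_prod, Set.mem_Icc]
    omega
  obtain ⟨t, ht⟩ : ∃ t, ∀ s, (D t).ncard ≤ (D s).ncard :=
    ⟨Function.argmin fun s => (D s).ncard, fun s => Function.argmin_le (fun s => (D s).ncard) s⟩
  refine ⟨t, ?_⟩
  have hsub : D (t + 1) ⊆ D t := by
    intro z hz h
    refine hz ?_
    rw [Function.iterate_succ_apply']
    exact erode_eq_none h
  have heq := Set.eq_of_subset_of_ncard_le hsub (ht (t + 1)) (hfin t)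
  funext i j
  by_cases h : (erode V)^[t] P i j = none
  · rw [h, erode_eq_none h]
  · have h1 : (i, j) ∈ D (t + 1) := heq ▸ (show (i, j) ∈ D t from h)
    have h2 : erode V ((erode V)^[t] P) i j ≠ none := by
      rw [← Function.iterate_succ_apply' (erode V)]
      exact h1
    unfold erode at h2 ⊢
    split_ifs at h2 ⊢ with hV
    · rfl
    · exact absurd rfl h2

/-- In a square of four cells, a tile on top left and a tile on bottom right force a tile on
bottom left. -/
def IsDiagonal (V : (ℤ → ℤ → Option T) → Prop) : Prop :=
  ∀ P, V P → P 0 0 ≠ none → P 1 (-1) ≠ none → P 0 (-1) ≠ none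

/-- The source of the letter at a cell without tile is the cell above or, below a tile, the
cell to the right, which has no tile by the diagonal condition. Followed backwards, the sources
lead out of every square, hence the letters that surround the square reach the cell. -/
theorem exists_iterate_eq_of_tiles_eq_none (hdiag : IsDiagonal V) {M : ℕ} {P : ℤ → ℤ → Option T}
    (hfix : erode V P = P) (Z : K → ℤ → ℤ → K ⊕ T) (hZ : ∀ k, tiles (Z k) = P)
    (hout : ∀ k i j, (M : ℤ) < i ∨ (M : ℤ) < j → Z k i j = .inl k) {i j : ℤ}
    (hij : P i j = none) :
    ∃ n, ∀ k, (planeStep (tileRule V d))^[n] (Z k) i j = .inl k := by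
  obtain ⟨m, hm⟩ : ∃ m, ((M : ℤ) + 1 - i).toNat + ((M : ℤ) + 1 - j).toNat ≤ m := ⟨_, le_rfl⟩
  have hiter : ∀ n k, tiles ((planeStep (tileRule V d))^[n] (Z k)) = P := by
    intro n k
    rw [tiles_iterate_planeStep, hZ]
    exact Function.iterate_fixed hfix n
  induction m generalizing i j with
  | zero => exact ⟨0, fun k => hout k i j (by omega)⟩
  | succ m ih =>
    by_cases hM : (M : ℤ) < i ∨ (M : ℤ) < j
    · exact ⟨0, fun k => hout k i j hM⟩
    · by_cases hup : P i (j + 1) = none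
      · obtain ⟨n, hn⟩ := ih hup (by omega)
        refine ⟨n + 1, fun k => ?_⟩
        rw [Function.iterate_succ_apply']
        exact planeStep_of_up (by rw [hiter, hij]) (hn k)
      · have hright : P (i + 1) j = none := by
          by_contra hr
          refine hdiag _ (isValidTiling_of_erode_eq hfix i (j + 1) hup) ?_ ?_ ?_
          · simpa [around] using hup
          · simpa [around] using hr
          · simpa [around] using hij
        obtain ⟨n, hn⟩ := ih hright (by omega)
        refine ⟨n + 1, fun k => ?_⟩
        rw [Function.iterate_succ_apply']
        exact planeStep_of_right (by rw [hiter, hij]) (by rw [hiter]; exact hup) (hn k)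

theorem exists_divergence (hdiag : IsDiagonal V) {L : ℕ}
    (hole : ∀ P, (∃ M, IsBoundedTiling M P) → IsValidTiling V P →
      ∃ j : ℤ, j.natAbs ≤ L ∧ P 0 j = none)
    {k₀ k₁ : K} (hne : k₀ ≠ k₁) (X : ℤ → ℤ → K ⊕ T) (M : ℕ) :
    ∃ (Y : ℤ → ℤ → K ⊕ T) (n : ℕ) (j : ℤ),
      (∀ i j : ℤ, i.natAbs ≤ M → j.natAbs ≤ M → X i j = Y i j) ∧ j.natAbs ≤ L ∧
        (planeStep (tileRule V d))^[n] X 0 j ≠ (planeStep (tileRule V d))^[n] Y 0 j := by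
  let fill : K → ℤ → ℤ → K ⊕ T := fun k i j =>
    if i.natAbs ≤ M ∧ j.natAbs ≤ M then X i j else .inl k
  let P₀ : ℤ → ℤ → Option T := fun i j =>
    if i.natAbs ≤ M ∧ j.natAbs ≤ M then tiles X i j else none
  have hfill : ∀ k, tiles (fill k) = P₀ := by
    intro k
    funext i j
    simp only [tiles, fill, P₀]
    split_ifs <;> rfl
  have hP₀ : IsBoundedTiling M P₀ := by
    intro i j h
    by_contra hc
    exact h (if_neg hc)
  have hout : ∀ t k i j, (M : ℤ) < i ∨ (M : ℤ) < j →
      (planeStep (tileRule V d))^[t] (fill k) i j = .inl k := by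
    intro t k
    induction t with
    | zero => exact fun i j h => if_neg (by omega)
    | succ t ih =>
      intro i j h
      rw [Function.iterate_succ_apply']
      exact planeStep_of_up (by simp [tiles, ih i j h]) (ih i (j + 1) (by omega))
  obtain ⟨t, ht⟩ := exists_erode_iterate_eq (V := V) hP₀
  obtain ⟨j, hjL, hj⟩ := hole _
    ⟨M, fun a b h => hP₀ a b fun h0 => h (iterate_erode_eq_none h0 t)⟩
    (isValidTiling_of_erode_eq ht)
  obtain ⟨n, hn⟩ := exists_iterate_eq_of_tiles_eq_none (d := d) hdiag ht
    (fun k => (planeStep (tileRule V d))^[t] (fill k))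
    (fun k => by rw [tiles_iterate_planeStep, hfill]) (hout t) hj
  have hn' : ∀ k, (planeStep (tileRule V d))^[n + t] (fill k) 0 j = .inl k := by
    intro k
    rw [Function.iterate_add_apply]
    exact hn k
  have hagree : ∀ (k : K) (i j : ℤ), i.natAbs ≤ M → j.natAbs ≤ M → X i j = fill k i j :=
    fun k i j hi hj => (if_pos ⟨hi, hj⟩).symm
  by_cases h : (planeStep (tileRule V d))^[n + t] X 0 j = .inl k₀
  · refine ⟨fill k₁, n + t, j, hagree k₁, hjL, ?_⟩
    rw [h, hn']
    simpa using hne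
  · refine ⟨fill k₀, n + t, j, hagree k₀, hjL, ?_⟩
    rw [hn']
    exact h

/-- A valid tiling stays in place, whatever lies beyond the immediate surroundings of its
tiles. -/
theorem iterate_eq_of_isValidTiling (hV : IsNearestNeighbor V) {P : ℤ → ℤ → Option T}
    (hP : IsValidTiling V P) {Y : ℤ → ℤ → K ⊕ T}
    (hY : ∀ i j, P i j ≠ none → ∀ a b : ℤ, a.natAbs ≤ 1 → b.natAbs ≤ 1 →
      tiles Y (i + a) (j + b) = P (i + a) (j + b))
    (n : ℕ) {i j : ℤ} {t : T} (hij : P i j = some t) :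
    (planeStep (tileRule V d))^[n] Y i j = .inr t := by
  have hn : ∀ i j, P i j ≠ none → ∀ a b : ℤ, a.natAbs ≤ 1 → b.natAbs ≤ 1 →
      (erode V)^[n] (tiles Y) (i + a) (j + b) = P (i + a) (j + b) := by
    induction n with
    | zero => exact hY
    | succ n ih =>
      intro i j hij a b ha hb
      rw [Function.iterate_succ_apply']
      by_cases hab : P (i + a) (j + b) = none
      · rw [hab]
        exact erode_eq_none (by rw [ih i j hij a b ha hb, hab])
      · have h := hV _ _ fun a' b' ha' hb' => ih (i + a) (j + b) hab a' b' ha' hb'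
        rw [erode, if_pos, ih i j hij a b ha hb]
        exact h ▸ hP _ _ hab
  have h := hn i j (by simp [hij]) 0 0 (by decide) (by decide)
  rw [← tiles_iterate_planeStep (d := d), add_zero, add_zero, hij] at h
  simpa [tiles] using h

/-- The automaton of `tileRule`. -/
noncomputable def tileAutomaton (V : (ℤ → ℤ → Option T) → Prop) (d : K) :
    CellularAutomaton 2 (K ⊕ T) :=
  .ofPlaneRule (tileRule V d) (.inl d)

/-- If every finite valid tiling leaves a cell free at bounded distance from the origin, the
automaton is sensitive. -/
theorem sensitive_tileAutomaton (hV : IsNearestNeighbor V) (hdiag : IsDiagonal V) {L : ℕ}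
    (hole : ∀ P, (∃ M, IsBoundedTiling M P) → IsValidTiling V P →
      ∃ j : ℤ, j.natAbs ≤ L ∧ P 0 j = none)
    [Nontrivial K] (d : K) : (tileAutomaton V d).Sensitive := by
  obtain ⟨k₀, k₁, hne⟩ := exists_pair_ne K
  refine ⟨(2 : ℝ)⁻¹ ^ (L + 1), by positivity, fun δ hδ x => ?_⟩
  obtain ⟨M, hM⟩ := exists_half_pow_lt hδ
  obtain ⟨Y, n, j, hXY, hj, hn⟩ := exists_divergence (d := d) hdiag hole hne (toPlane x) M
  obtain ⟨y, rfl⟩ := exists_eq_toPlane Y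
  refine ⟨y, n, (configDist_le_of_agree fun i hi => ?_).trans_lt hM, ?_⟩
  · rw [eq_pair i] at hi ⊢
    have := supNorm_pair_le.1 hi.le
    exact hXY _ _ this.1 this.2
  · have hG := isNearestNeighbor_tileRule hV d
    rw [← toPlane_iterate_globalMap hG (.inl d), ← toPlane_iterate_globalMap hG (.inl d)] at hn
    have h1 := le_configDist_of_ne (supNorm_pair_le.2 ⟨by simp, hj⟩) hn
    exact lt_of_lt_of_le (pow_lt_pow_right_of_lt_one₀ (by norm_num) (by norm_num) (by omega)) h1

/-- A finite valid tiling that covers a large square is not disturbed from afar, whence a small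
sensitivity constant. -/
theorem sensitivityConstant_tileAutomaton_le (hV : IsNearestNeighbor V) (d : K)
    (hF : (tileAutomaton V d).Sensitive) {P : ℤ → ℤ → Option T} (hP : IsValidTiling V P)
    {M : ℕ} (hbdd : IsBoundedTiling M P) {N : ℕ}
    (hcov : ∀ i j : ℤ, i.natAbs < N → j.natAbs < N → P i j ≠ none) :
    (tileAutomaton V d).sensitivityConstant ≤ (2 : ℝ)⁻¹ ^ N := by
  refine csSup_le hF ?_
  rintro ε ⟨-, hε⟩
  let X : ℤ → ℤ → K ⊕ T := fun i j => (P i j).elim (.inl d) .inr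
  have hX : ∀ i j, tiles X i j = P i j := by
    intro i j
    simp only [tiles, X]
    cases P i j <;> rfl
  obtain ⟨x, hx⟩ := exists_eq_toPlane X
  obtain ⟨y, n, hxy, hn⟩ := hε ((2 : ℝ)⁻¹ ^ (M + 1)) (by positivity) x
  have hagree : ∀ i j : ℤ, i.natAbs ≤ M + 1 → j.natAbs ≤ M + 1 → toPlane x i j = toPlane y i j := by
    intro i j hi hj
    by_contra hne
    exact hxy.not_ge (le_configDist_of_ne (supNorm_pair_le.2 ⟨hi, hj⟩) hne)
  refine hn.le.trans (configDist_le_of_agree fun i hi => ?_)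
  have hG := isNearestNeighbor_tileRule hV d
  have hN : (i 0).natAbs < N ∧ (i 1).natAbs < N :=
    ⟨(natAbs_le_supNorm i 0).trans_lt hi, (natAbs_le_supNorm i 1).trans_lt hi⟩
  obtain ⟨t, ht⟩ := Option.ne_none_iff_exists'.1 (hcov _ _ hN.1 hN.2)
  have key : ∀ z : Config 2 (K ⊕ T),
      (∀ i j : ℤ, i.natAbs ≤ M + 1 → j.natAbs ≤ M + 1 → toPlane z i j = X i j) →
      ((tileAutomaton V d).globalMap^[n] z) i = .inr t := by
    intro z hz
    rw [eq_pair i]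
    show toPlane _ _ _ = _
    rw [tileAutomaton, toPlane_iterate_globalMap hG]
    refine iterate_eq_of_isValidTiling hV hP (fun i j hij a b ha hb => ?_) n ht
    have := hbdd i j hij
    rw [← hX, tiles, tiles, hz _ _ (by omega) (by omega)]
  rw [key x fun _ _ _ _ => by rw [hx], key y fun i j hi hj => by rw [← hagree i j hi hj, hx]]

end Tiles

/-! ### Space-time diagrams of Turing machines -/

section Machines

open Turing

variable {Γ Q : Type}

section

variable [Inhabited Q]

/-- What the machine does at a cell, which holds a symbol and possibly the head. -/
def action (M : TM0.Machine Γ Q) (c : Γ × Option Q) : Option (Q × TM0.Stmt Γ) :=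
  c.2.bind fun q => M q c.1

/-- The state in which the head leaves a cell in the direction `d`, if it does. -/
def departure (M : TM0.Machine Γ Q) (d : Dir) (c : Γ × Option Q) : Option Q :=
  match action M c with
  | some (q, .move d') => if d' = d then some q else none
  | _ => none

/-- The content of a cell one step later, from the contents of the cell and its neighbours. -/
def nextCell (M : TM0.Machine Γ Q) (a c b : Γ × Option Q) : Γ × Option Q :=
  match action M c with
  | some (q, .write s) => (s, some q)
  | _ => (c.1, (departure M .right a).or (departure M .left b))

theorem departure_eq_none {M : TM0.Machine Γ Q} {d : Dir} {c : Γ × Option Q} (h : c.2 = none) :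
    departure M d c = none := by
  simp [departure, action, h]

theorem nextCell_congr (M : TM0.Machine Γ Q) {a a' b b' : Γ × Option Q} (c : Γ × Option Q)
    (ha : a = a' ∨ a.2 = none ∧ a'.2 = none) (hb : b = b' ∨ b.2 = none ∧ b'.2 = none) :
    nextCell M a c b = nextCell M a' c b' := by
  have h1 : departure M .right a = departure M .right a' := by
    rcases ha with rfl | ⟨h, h'⟩
    · rfl
    · rw [departure_eq_none h, departure_eq_none h']
  have h2 : departure M .left b = departure M .left b' := by
    rcases hb with rfl | ⟨h, h'⟩
    · rfl
    · rw [departure_eq_none h, departure_eq_none h']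
  rw [nextCell, nextCell, h1, h2]

end

section

variable [Inhabited Γ]

/-- The contents of the cells in the configuration `c`, with the head at `p`. -/
def rowOf (c : TM0.Cfg Γ Q) (p x : ℤ) : Γ × Option Q :=
  (c.Tape.nth (x - p), if x = p then some c.q else none)

theorem rowOf_self (c : TM0.Cfg Γ Q) (p : ℤ) : rowOf c p p = (c.Tape.1, some c.q) := by
  simp [rowOf, Tape.nth_zero]

theorem rowOf_snd_of_ne (c : TM0.Cfg Γ Q) {p x : ℤ} (h : x ≠ p) : (rowOf c p x).2 = none := by
  simp [rowOf, h]

end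

variable [Inhabited Γ] [Inhabited Q]

/-- The configuration of the machine `M` on the input `l` after `n` steps, or `none` if it has
halted before. -/
def configAt (M : TM0.Machine Γ Q) (l : List Γ) : ℕ → Option (TM0.Cfg Γ Q)
  | 0 => some (TM0.init l)
  | n + 1 => (configAt M l n).bind (TM0.step M)

theorem exists_rowOf_step {M : TM0.Machine Γ Q} {c c' : TM0.Cfg Γ Q} (h : TM0.step M c = some c')
    (p : ℤ) :
    ∃ p' : ℤ, (p' - p).natAbs ≤ 1 ∧ ∀ x,
      rowOf c' p' x = nextCell M (rowOf c p (x - 1)) (rowOf c p x) (rowOf c p (x + 1)) := by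
  obtain ⟨q, T⟩ := c
  obtain ⟨⟨q', s⟩, hM, rfl⟩ := Option.map_eq_some_iff.1 h
  have hact : action M (rowOf ⟨q, T⟩ p p) = some (q', s) := by
    rw [rowOf_self]
    exact hM
  have hne : ∀ x, x ≠ p → action M (rowOf ⟨q, T⟩ p x) = none := fun x hx => by
    simp [action, rowOf_snd_of_ne _ hx]
  rcases s with (_ | _) | s
  · refine ⟨p - 1, by omega, fun x => ?_⟩
    have e : x - (p - 1) - 1 = x - p := by ring
    by_cases hx : x = p
    · subst hx
      have h1 := departure_eq_none (M := M) (d := .right)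
        (rowOf_snd_of_ne ⟨q, T⟩ (show x - 1 ≠ x by omega))
      have h2 := departure_eq_none (M := M) (d := .left)
        (rowOf_snd_of_ne ⟨q, T⟩ (show x + 1 ≠ x by omega))
      rw [nextCell, hact]
      simp only [h1, h2]
      simp only [rowOf, sub_self, Tape.move_left_nth, e, Option.or_none]
      rw [if_neg (by omega)]
    · have h1 : departure M .right (rowOf ⟨q, T⟩ p (x - 1)) = none := by
        by_cases hx1 : x - 1 = p
        · rw [hx1, departure, hact]; rfl
        · exact departure_eq_none (rowOf_snd_of_ne _ hx1)
      have h2 : departure M .left (rowOf ⟨q, T⟩ p (x + 1)) =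
          if x = p - 1 then some q' else none := by
        by_cases hx1 : x + 1 = p
        · rw [hx1, departure, hact, if_pos (by omega)]; rfl
        · rw [departure_eq_none (rowOf_snd_of_ne _ hx1), if_neg (by omega)]
      rw [nextCell, hne x hx]
      simp only [h1, h2]
      simp [rowOf, Tape.move_left_nth, e]
  · refine ⟨p + 1, by omega, fun x => ?_⟩
    have e : x - (p + 1) + 1 = x - p := by ring
    by_cases hx : x = p
    · subst hx
      have h1 := departure_eq_none (M := M) (d := .right)
        (rowOf_snd_of_ne ⟨q, T⟩ (show x - 1 ≠ x by omega))
      have h2 := departure_eq_none (M := M) (d := .left)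
        (rowOf_snd_of_ne ⟨q, T⟩ (show x + 1 ≠ x by omega))
      rw [nextCell, hact]
      simp only [h1, h2]
      simp [rowOf, Tape.move_right_nth]
    · have h1 : departure M .left (rowOf ⟨q, T⟩ p (x + 1)) = none := by
        by_cases hx1 : x + 1 = p
        · rw [hx1, departure, hact]; rfl
        · exact departure_eq_none (rowOf_snd_of_ne _ hx1)
      have h2 : departure M .right (rowOf ⟨q, T⟩ p (x - 1)) =
          if x = p + 1 then some q' else none := by
        by_cases hx1 : x - 1 = p
        · rw [hx1, departure, hact, if_pos (by omega)]; rfl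
        · rw [departure_eq_none (rowOf_snd_of_ne _ hx1), if_neg (by omega)]
      rw [nextCell, hne x hx]
      simp only [h1, h2]
      simp [rowOf, Tape.move_right_nth, e]
  · refine ⟨p, by omega, fun x => ?_⟩
    by_cases hx : x = p
    · subst hx
      rw [nextCell, hact]
      simp only [rowOf, sub_self, Tape.write_nth, if_true]
    · have h1 : departure M .right (rowOf ⟨q, T⟩ p (x - 1)) = none := by
        by_cases hx1 : x - 1 = p
        · rw [hx1, departure, hact]
        · exact departure_eq_none (rowOf_snd_of_ne _ hx1)
      have h2 : departure M .left (rowOf ⟨q, T⟩ p (x + 1)) = none := by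
        by_cases hx1 : x + 1 = p
        · rw [hx1, departure, hact]
        · exact departure_eq_none (rowOf_snd_of_ne _ hx1)
      rw [nextCell, hne x hx]
      simp only [h1, h2]
      simp [rowOf, Tape.write_nth, hx, sub_eq_zero]

/-- The space-time diagram of `M` on the input `l`: the content of the cell `x` after `n` steps.
At first the head is at `0` and the input to its right. -/
def cellAt (M : TM0.Machine Γ Q) (l : List Γ) : ℕ → ℤ → Γ × Option Q
  | 0, x => (if 0 ≤ x then l.getI x.toNat else default, if x = 0 then some default else none)
  | n + 1, x => nextCell M (cellAt M l n (x - 1)) (cellAt M l n x) (cellAt M l n (x + 1))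

theorem cellAt_zero (M : TM0.Machine Γ Q) (l : List Γ) (x : ℤ) :
    cellAt M l 0 x = rowOf (TM0.init l) 0 x := by
  rw [cellAt, rowOf, sub_zero]
  refine Prod.ext ?_ rfl
  show _ = Tape.nth (Tape.mk' _ _) x
  rcases x with n | n
  · have : (0 : ℤ) ≤ Int.ofNat n := Int.natCast_nonneg n
    rw [if_pos this]
    show _ = Tape.nth _ (n : ℤ)
    rw [Tape.mk'_nth_nat, ListBlank.nth_mk]
    rfl
  · rw [if_neg (by omega)]
    show _ = (ListBlank.mk ([] : List Γ)).nth n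
    rw [ListBlank.nth_mk]
    simp

theorem exists_cellAt_succ {M : TM0.Machine Γ Q} {l : List Γ} {n : ℕ} {c c' : TM0.Cfg Γ Q} {p : ℤ}
    (hrow : ∀ x, cellAt M l n x = rowOf c p x) (hc : TM0.step M c = some c') :
    ∃ p' : ℤ, (p' - p).natAbs ≤ 1 ∧ ∀ x, cellAt M l (n + 1) x = rowOf c' p' x := by
  obtain ⟨p', hp', h⟩ := exists_rowOf_step hc p
  refine ⟨p', hp', fun x => ?_⟩
  rw [h, cellAt, hrow, hrow, hrow]

theorem exists_cellAt_eq_rowOf {M : TM0.Machine Γ Q} {l : List Γ} {n : ℕ} {c : TM0.Cfg Γ Q}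
    (hc : configAt M l n = some c) :
    ∃ p : ℤ, p.natAbs ≤ n ∧ ∀ x, cellAt M l n x = rowOf c p x := by
  induction n generalizing c with
  | zero =>
    obtain rfl : TM0.init l = c := Option.some.inj hc
    exact ⟨0, by simp, cellAt_zero M l⟩
  | succ n ih =>
    obtain ⟨b, hb, hbc⟩ := Option.bind_eq_some_iff.1 hc
    obtain ⟨p, hp, hrow⟩ := ih hb
    obtain ⟨p', hp', hrow'⟩ := exists_cellAt_succ hrow hbc
    exact ⟨p', by omega, hrow'⟩

theorem configAt_ne_none_of_le {M : TM0.Machine Γ Q} {l : List Γ} {m n : ℕ} (hmn : m ≤ n)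
    (h : configAt M l n ≠ none) : configAt M l m ≠ none := by
  induction hmn with
  | refl => exact h
  | step _ ih => exact ih fun h0 => h (by rw [configAt, h0]; rfl)

/-- As long as the machine runs, its head has moved at most one cell per step, and it has an
instruction to follow. -/
theorem cellAt_head {M : TM0.Machine Γ Q} {l : List Γ} {n : ℕ} (h : configAt M l (n + 1) ≠ none)
    {x : ℤ} {q : Q} (hq : (cellAt M l n x).2 = some q) :
    x.natAbs ≤ n ∧ M q (cellAt M l n x).1 ≠ none := by
  obtain ⟨c, hc⟩ := Option.ne_none_iff_exists'.1 h
  obtain ⟨⟨q₀, T⟩, hb, hbc⟩ := Option.bind_eq_some_iff.1 hc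
  obtain ⟨p, hp, hrow⟩ := exists_cellAt_eq_rowOf hb
  have hx : x = p := by
    by_contra hne
    rw [hrow, rowOf_snd_of_ne _ hne] at hq
    cases hq
  subst hx
  rw [hrow, rowOf_self] at hq ⊢
  obtain rfl : q₀ = q := Option.some.inj hq
  refine ⟨hp, fun h0 => ?_⟩
  rw [TM0.step] at hbc
  simp only at h0
  rw [h0] at hbc
  cases hbc

end Machines

/-! ### Tilings by space-time diagrams -/

theorem int_spread_right {p : ℤ → Prop} {a b : ℤ} (ha : p a)
    (hs : ∀ x, a ≤ x → x < b → p x → p (x + 1)) : ∀ x, a ≤ x → x ≤ b → p x := by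
  intro x hx
  induction x, hx using Int.leInduction with
  | base => exact fun _ => ha
  | succ x hx ih => exact fun h => hs x hx (by omega) (ih (by omega))

theorem int_spread_left {p : ℤ → Prop} {a b : ℤ} (hb : p b)
    (hs : ∀ x, a < x → x ≤ b → p x → p (x - 1)) : ∀ x, a ≤ x → x ≤ b → p x := by
  intro x hx hxb
  induction x, hxb using Int.leInductionDown with
  | base => exact hb
  | pred x hxb ih => exact hs x (by omega) hxb (ih (by omega))

theorem exists_run_end {p : ℤ → Prop} (h0 : p 0) {B : ℕ} (hB : ∀ x, p x → x ≤ B) :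
    ∃ n : ℤ, 0 ≤ n ∧ (∀ x, 0 ≤ x → x ≤ n → p x) ∧ ¬ p (n + 1) := by
  classical
  have hex : ∃ n : ℕ, ¬ p (n + 1) := ⟨B, fun h => by have := hB _ h; omega⟩
  refine ⟨Nat.find hex, Int.natCast_nonneg _, int_spread_right h0 fun x hx hlt _ => ?_,
    Nat.find_spec hex⟩
  lift x to ℕ using hx
  exact not_not.1 (Nat.find_min hex (by omega))

/-- A sequence that starts at `0`, ends at `n + 1`, and grows by `1` at each step except that it
may repeat `0` and `n + 1`. -/
theorem exists_tag_origin {τ : ℤ → ℕ} {n : ℕ} {x₀ x₁ : ℤ} (h : x₀ ≤ x₁) (h0 : τ x₀ = 0)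
    (h1 : τ x₁ = n + 1)
    (hs : ∀ x, x₀ ≤ x → x < x₁ →
      τ (x + 1) = τ x + 1 ∨ (τ (x + 1) = τ x ∧ (τ x = 0 ∨ τ x = n + 1)))
    (hle : ∀ x, x₀ ≤ x → x ≤ x₁ → τ x ≤ n + 1) :
    ∃ p, x₀ < p ∧ p ≤ x₁ ∧
      ∀ x, x₀ ≤ x → x ≤ x₁ → (τ x : ℤ) = max 0 (min ((n : ℤ) + 1) (x - p + 1)) := by
  have key : ∀ x, x₀ ≤ x → x ≤ x₁ → (∀ x', x₀ ≤ x' → x' ≤ x → τ x' = 0) ∨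
      ∃ p, x₀ < p ∧ p ≤ x ∧
        ∀ x', x₀ ≤ x' → x' ≤ x → (τ x' : ℤ) = max 0 (min ((n : ℤ) + 1) (x' - p + 1)) := by
    refine int_spread_right (.inl fun x' h h' => ?_) fun x hx hlt ih => ?_
    · rw [le_antisymm h' h, h0]
    · rcases ih with ih | ⟨p, hp, hpx, ih⟩
      · have hx0 := ih x hx le_rfl
        rcases hs x hx hlt with hs | ⟨hs, -⟩
        · refine .inr ⟨x + 1, by omega, le_rfl, fun x' h h' => ?_⟩
          rcases h'.lt_or_eq with hlt' | rfl
          · rw [ih x' h (by omega)]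
            omega
          · rw [hs, hx0]
            omega
        · refine .inl fun x' h h' => ?_
          rcases h'.lt_or_eq with hlt' | rfl
          · exact ih x' h (by omega)
          · rw [hs, hx0]
      · refine .inr ⟨p, hp, by omega, fun x' h h' => ?_⟩
        rcases h'.lt_or_eq with hlt' | rfl
        · exact ih x' h (by omega)
        · have h2 := ih x hx le_rfl
          have h3 := hle (x + 1) h (by omega)
          have h4 := hs x hx hlt
          omega
  rcases key x₁ h le_rfl with h2 | h2
  · have := h2 x₁ h le_rfl
    omega
  · exact h2

section Diagrams

open Turing

variable {Γ Q : Type} [Inhabited Γ] [Inhabited Q]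

/-- The tiles of the diagrams of a machine on the input `l`: the content of a cell together with
a tag. Along a row, the tags are `0` on the left of the origin, then `1`, `2`, … up to
`l.length + 1`, which is repeated up to the right end. -/
abbrev DiagramTile (Γ Q : Type) (l : List Γ) : Type := Fin (l.length + 2) × Γ × Option Q

/-- The content at time `0` of a cell with tag `s`. -/
def initCell (Q : Type) [Inhabited Q] (l : List Γ) (s : ℕ) : Γ × Option Q :=
  (if s = 0 then default else l.getI (s - 1), if s = 1 then some default else none)

/-- The content shown by a cell, which is blank if there is no tile. -/
def contentOf {l : List Γ} (o : Option (DiagramTile Γ Q l)) : Γ × Option Q :=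
  o.elim (default, none) Prod.snd

/-- The local constraint of the tilings by space-time diagrams, time going upwards: the tiles form
rectangles, the tags of a row run from `0` to `l.length + 1`, the lowest row shows the initial
configuration and every other row the successor of the row below, and the head is neither at the
left or right end nor about to halt. The tags matter in the lowest row only. -/
structure DiagramConstraint (M : TM0.Machine Γ Q) (l : List Γ)
    (P : ℤ → ℤ → Option (DiagramTile Γ Q l)) : Prop where
  diag_up : P 0 0 ≠ none → P 1 1 ≠ none → P 1 0 ≠ none ∧ P 0 1 ≠ none
  diag_down : P 0 0 ≠ none → P 1 (-1) ≠ none → P 1 0 ≠ none ∧ P 0 (-1) ≠ none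
  tag_left_end : ∀ t ∈ P 0 0, P (-1) 0 = none → (t.1 : ℕ) = 0
  tag_right_end : ∀ t ∈ P 0 0, P 1 0 = none → (t.1 : ℕ) = l.length + 1
  tag_succ : ∀ t ∈ P 0 0, ∀ t' ∈ P 1 0, (t'.1 : ℕ) = t.1 + 1 ∨
    ((t'.1 : ℕ) = t.1 ∧ ((t.1 : ℕ) = 0 ∨ (t.1 : ℕ) = l.length + 1))
  bottom : ∀ t ∈ P 0 0, P 0 (-1) = none → t.2 = initCell Q l t.1
  above : ∀ t ∈ P 0 0, ∀ t' ∈ P 0 (-1),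
    t.2 = nextCell M (contentOf (P (-1) (-1))) t'.2 (contentOf (P 1 (-1)))
  head : ∀ t ∈ P 0 0, ∀ q ∈ t.2.2, P (-1) 0 ≠ none ∧ P 1 0 ≠ none ∧ M q t.2.1 ≠ none

variable {M : TM0.Machine Γ Q} {l : List Γ}

theorem isNearestNeighbor_diagramConstraint (M : TM0.Machine Γ Q) (l : List Γ) :
    IsNearestNeighbor (DiagramConstraint M l) := by
  have key : ∀ X Y : ℤ → ℤ → Option (DiagramTile Γ Q l),
      (∀ a b : ℤ, a.natAbs ≤ 1 → b.natAbs ≤ 1 → X a b = Y a b) →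
        DiagramConstraint M l X → DiagramConstraint M l Y := by
    intro X Y h hX
    have h00 := h 0 0 (by decide) (by decide)
    have h10 := h 1 0 (by decide) (by decide)
    have h01 := h 0 1 (by decide) (by decide)
    have h11 := h 1 1 (by decide) (by decide)
    have hl0 := h (-1) 0 (by decide) (by decide)
    have hld := h (-1) (-1) (by decide) (by decide)
    have h0d := h 0 (-1) (by decide) (by decide)
    have h1d := h 1 (-1) (by decide) (by decide)
    constructor <;> simp only [← h00, ← h10, ← h01, ← h11, ← hl0, ← hld, ← h0d, ← h1d]
    exacts [hX.diag_up, hX.diag_down, hX.tag_left_end, hX.tag_right_end, hX.tag_succ, hX.bottom,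
      hX.above, hX.head]
  exact fun X Y h => propext
    ⟨key X Y h, key Y X fun a b ha hb => (h a b ha hb).symm⟩

theorem isDiagonal_diagramConstraint (M : TM0.Machine Γ Q) (l : List Γ) :
    IsDiagonal (DiagramConstraint M l) :=
  fun _ hP h0 h1 => (hP.diag_down h0 h1).2

section Rectangles

variable {P : ℤ → ℤ → Option (DiagramTile Γ Q l)} (hP : IsValidTiling (DiagramConstraint M l) P)
include hP

theorem diag_up_of_valid {x y : ℤ} (h : P x y ≠ none) (h' : P (x + 1) (y + 1) ≠ none) :
    P (x + 1) y ≠ none ∧ P x (y + 1) ≠ none := by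
  simpa [around] using (hP x y h).diag_up (by simpa [around] using h) (by simpa [around] using h')

theorem diag_down_of_valid {x y : ℤ} (h : P x (y + 1) ≠ none) (h' : P (x + 1) y ≠ none) :
    P (x + 1) (y + 1) ≠ none ∧ P x y ≠ none := by
  simpa [around] using
    (hP x (y + 1) h).diag_down (by simpa [around] using h) (by simpa [around] using h')

/-- The diagonal conditions force the tiles to form rectangles; of the rectangle that contains a
given column, this is the part up to the top of the column. -/
theorem exists_rectangle {B : ℕ} (hbdd : IsBoundedTiling B P) {t : ℕ}
    (hcol : ∀ j : ℤ, 0 ≤ j → j ≤ t → P 0 j ≠ none) :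
    ∃ x₀ x₁ y₀ : ℤ, x₀ ≤ x₁ ∧ y₀ ≤ 0 ∧
      (∀ x, x₀ ≤ x → x ≤ x₁ → P x (y₀ - 1) = none) ∧
      ∀ y, y₀ ≤ y → y ≤ t →
        (∀ x, x₀ ≤ x → x ≤ x₁ → P x y ≠ none) ∧ P (x₀ - 1) y = none ∧ P (x₁ + 1) y = none := by
  obtain ⟨b, hb, hdown, hbot⟩ := exists_run_end (p := fun y => P 0 (-y) ≠ none) (B := B)
    (by simpa using hcol 0 le_rfl (by simp)) (fun y hy => by have := hbdd _ _ hy; omega)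
  obtain ⟨x₁, hx₁, hright, hend₁⟩ := exists_run_end (p := fun x => P x (-b) ≠ none) (B := B)
    (hdown b hb le_rfl) (fun x hx => by have := hbdd _ _ hx; omega)
  obtain ⟨a, ha, hleft, hend₀⟩ := exists_run_end (p := fun x => P (-x) (-b) ≠ none) (B := B)
    (by simpa using hdown b hb le_rfl) (fun x hx => by have := hbdd _ _ hx; omega)
  rw [not_not] at hbot hend₁ hend₀
  have hrow : ∀ x, -a ≤ x → x ≤ x₁ → P x (-b) ≠ none := by
    intro x hx hx'
    rcases le_total 0 x with h | h
    · exact hright x h hx'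
    · simpa using hleft (-x) (by omega) (by omega)
  have hcol' : ∀ y, -b ≤ y → y ≤ t → P 0 y ≠ none := by
    intro y hy hy'
    rcases le_total 0 y with h | h
    · exact hcol y h hy'
    · simpa using hdown (-y) (by omega) (by omega)
  have ebot : -(b + 1) = -b - 1 := by ring
  have hstep : ∀ x y, P x y ≠ none → P (x + 1) (y - 1) ≠ none →
      P (x + 1) y ≠ none ∧ P x (y - 1) ≠ none := by
    intro x y h h'
    simpa using diag_down_of_valid hP (x := x) (y := y - 1) (by simpa using h) h'
  have hstep' : ∀ x y, P (x - 1) (y - 1) ≠ none → P x y ≠ none →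
      P x (y - 1) ≠ none ∧ P (x - 1) y ≠ none := by
    intro x y h h'
    simpa using diag_up_of_valid hP (x := x - 1) (y := y - 1) h (by simpa using h')
  refine ⟨-a, x₁, -b, by omega, by omega, ?_, ?_⟩
  · have hR : ∀ x, 0 ≤ x → x ≤ x₁ → P x (-b - 1) = none := by
      refine int_spread_right (ebot ▸ hbot) fun x hx hlt hnone => ?_
      by_contra h
      exact (hstep x (-b) (hrow x (by omega) (by omega)) h).2 hnone
    have hL : ∀ x, -a ≤ x → x ≤ 0 → P x (-b - 1) = none := by
      refine int_spread_left (ebot ▸ hbot) fun x hx hlt hnone => ?_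
      by_contra h
      exact (hstep' x (-b) h (hrow x (by omega) (by omega))).1 hnone
    intro x hx hx'
    rcases le_total 0 x with h | h
    exacts [hR x h hx', hL x hx h]
  · refine int_spread_right ⟨hrow, ?_, hend₁⟩ fun y hy hlt ⟨hfull, hnl, hnr⟩ => ?_
    · rwa [← neg_add']
    have htop := hcol' (y + 1) (by omega) (by omega)
    have hR : ∀ x, 0 ≤ x → x ≤ x₁ → P x (y + 1) ≠ none := by
      refine int_spread_right htop fun x hx hlt h => ?_
      exact (diag_down_of_valid hP h (hfull (x + 1) (by omega) (by omega))).1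
    have hL : ∀ x, -a ≤ x → x ≤ 0 → P x (y + 1) ≠ none := by
      refine int_spread_left htop fun x hx hlt h => ?_
      have := hstep' x (y + 1)
      rw [add_sub_cancel_right] at this
      exact (this (hfull (x - 1) (by omega) (by omega)) h).2
    refine ⟨fun x hx hx' => ?_, ?_, ?_⟩
    · rcases le_total 0 x with h | h
      exacts [hR x h hx', hL x hx h]
    · by_contra h
      refine (diag_down_of_valid hP h ?_).2 hnl
      rw [sub_add_cancel]
      exact hfull _ le_rfl (by omega)
    · by_contra h
      exact (diag_up_of_valid hP (hfull x₁ (by omega) le_rfl) h).1 hnr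

end Rectangles

theorem initCell_eq_cellAt (hl : l ≠ []) {s : ℕ} {x : ℤ}
    (h : (s : ℤ) = max 0 (min ((l.length : ℤ) + 1) (x + 1))) : initCell Q l s = cellAt M l 0 x := by
  have hpos : 0 < l.length := List.length_pos_iff.2 hl
  rw [initCell, cellAt]
  refine Prod.ext ?_ ?_
  · by_cases hx : 0 ≤ x
    · rw [if_neg (by omega), if_pos hx]
      by_cases hx' : x < l.length
      · rw [show s - 1 = x.toNat by omega]
      · rw [List.getI_eq_default _ (by omega), List.getI_eq_default _ (by omega)]
    · rw [if_pos (by omega), if_neg hx]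
  · show (if s = 1 then _ else _) = if x = 0 then _ else _
    by_cases hx : x = 0
    · rw [if_pos (by omega), if_pos hx]
    · rw [if_neg (by omega), if_neg hx]

/-- A finite valid tiling with `t + 1` tiles above each other contains the space-time diagram of
the machine up to the time `t`, hence the machine has not halted before. -/
theorem configAt_ne_none_of_column (hl : l ≠ [])
    {P : ℤ → ℤ → Option (DiagramTile Γ Q l)} (hP : IsValidTiling (DiagramConstraint M l) P)
    {B : ℕ} (hbdd : IsBoundedTiling B P) {t : ℕ}
    (hcol : ∀ j : ℤ, 0 ≤ j → j ≤ t → P 0 j ≠ none) : configAt M l t ≠ none := by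
  obtain ⟨x₀, x₁, y₀, hx, hy₀, hbelow, hrect⟩ := exists_rectangle hP hbdd hcol
  have hbotrow := hrect y₀ le_rfl (by omega)
  obtain ⟨p, hp₀, hp₁, htag⟩ : ∃ p, x₀ < p ∧ p ≤ x₁ ∧ ∀ x, x₀ ≤ x → x ≤ x₁ →
      (((P x y₀).elim 0 fun t => (t.1 : ℕ) : ℕ) : ℤ) =
        max 0 (min ((l.length : ℤ) + 1) (x - p + 1)) := by
    refine exists_tag_origin hx ?_ ?_ ?_ ?_
    · obtain ⟨t, ht⟩ := Option.ne_none_iff_exists'.1 (hbotrow.1 x₀ le_rfl hx)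
      rw [ht]
      exact (hP x₀ y₀ (by simp [ht])).tag_left_end t (by simpa [around] using ht)
        (by simpa [around, ← sub_eq_add_neg] using hbotrow.2.1)
    · obtain ⟨t, ht⟩ := Option.ne_none_iff_exists'.1 (hbotrow.1 x₁ hx le_rfl)
      rw [ht]
      exact (hP x₁ y₀ (by simp [ht])).tag_right_end t (by simpa [around] using ht)
        (by simpa [around] using hbotrow.2.2)
    · intro x hx hx'
      obtain ⟨t, ht⟩ := Option.ne_none_iff_exists'.1 (hbotrow.1 x hx (by omega))
      obtain ⟨t', ht'⟩ := Option.ne_none_iff_exists'.1 (hbotrow.1 (x + 1) (by omega) (by omega))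
      rw [ht, ht']
      exact (hP x y₀ (by simp [ht])).tag_succ t (by simpa [around] using ht) t'
        (by simpa [around] using ht')
    · intro x hx hx'
      cases P x y₀ with
      | none => simp
      | some t => exact Nat.lt_succ_iff.1 t.1.isLt
  have key : ∀ j : ℕ, j ≤ t → ∃ (c : TM0.Cfg Γ Q) (h : ℤ), configAt M l j = some c ∧
      (∀ x, cellAt M l j x = rowOf c h x) ∧ x₀ ≤ p + h ∧ p + h ≤ x₁ ∧
      ∀ x, x₀ ≤ x → x ≤ x₁ → ∀ t ∈ P x (y₀ + j), t.2 = cellAt M l j (x - p) := by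
    intro j
    induction j with
    | zero =>
      refine fun _ => ⟨TM0.init l, 0, rfl, cellAt_zero M l, by omega, by omega, ?_⟩
      intro x hx hx' t ht
      rw [Nat.cast_zero, add_zero] at ht
      rw [(hP x y₀ (Option.ne_none_iff_exists'.2 ⟨t, ht⟩)).bottom t (by simpa [around] using ht)
        (by simpa [around, ← sub_eq_add_neg] using hbelow x hx hx')]
      refine initCell_eq_cellAt hl ?_
      have := htag x hx hx'
      rw [ht] at this
      exact this
    | succ j ih =>
      intro hj
      obtain ⟨⟨q, T⟩, h, hc, hrow, hh₀, hh₁, hcont⟩ := ih (by omega)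
      have hrowj := hrect (y₀ + j) (by omega) (by omega)
      obtain ⟨th, hth⟩ := Option.ne_none_iff_exists'.1 (hrowj.1 (p + h) hh₀ hh₁)
      have hth2 : th.2 = (T.1, some q) := by
        rw [hcont _ hh₀ hh₁ th hth, hrow, add_sub_cancel_left, rowOf_self]
      obtain ⟨hl1, hr1, hM⟩ := (hP _ _ (Option.ne_none_iff_exists'.2 ⟨th, hth⟩)).head th
        (by simpa [around] using hth) q (by rw [hth2]; rfl)
      rw [hth2] at hM
      obtain ⟨⟨q', s⟩, hM'⟩ := Option.ne_none_iff_exists'.1 hM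
      -- The head is strictly inside the rectangle, hence still inside after its next move.
      have hin₀ : p + h ≠ x₀ := by
        rintro heq
        refine hl1 ?_
        rw [heq]
        simpa [around, ← sub_eq_add_neg] using hrowj.2.1
      have hin₁ : p + h ≠ x₁ := by
        rintro heq
        refine hr1 ?_
        rw [heq]
        simpa [around] using hrowj.2.2
      obtain ⟨c', hc'⟩ : ∃ c', TM0.step M ⟨q, T⟩ = some c' :=
        ⟨_, by rw [TM0.step]; simp only at hM' ⊢; rw [hM']; rfl⟩
      obtain ⟨h', hh', hrow'⟩ := exists_cellAt_succ hrow hc'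
      refine ⟨c', h', ?_, hrow', by omega, by omega, ?_⟩
      · rw [configAt, hc]
        exact hc'
      · intro x hx hx' tx htx
        obtain ⟨ty, hty⟩ := Option.ne_none_iff_exists'.1 (hrowj.1 x hx hx')
        have e : y₀ + ((j + 1 : ℕ) : ℤ) + -1 = y₀ + j := by push_cast; ring
        have habove := (hP _ _ (Option.ne_none_iff_exists'.2 ⟨tx, htx⟩)).above tx
          (by simpa [around] using htx) ty (by simp only [around]; rw [e, add_zero]; exact hty)
        rw [habove, hcont x hx hx' ty hty, cellAt]
        simp only [around]
        rw [e, ← sub_eq_add_neg]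
        -- Beyond the ends of the row there is no head, thus nothing that matters.
        refine nextCell_congr M _ ?_ ?_
        · by_cases hxl : x = x₀
          · refine .inr ⟨?_, ?_⟩
            · rw [hxl, hrowj.2.1]
              rfl
            · rw [hrow]
              exact rowOf_snd_of_ne _ (by omega)
          · left
            obtain ⟨u, hu⟩ := Option.ne_none_iff_exists'.1
              (hrowj.1 (x - 1) (by omega) (by omega))
            rw [hu]
            refine (hcont _ (by omega) (by omega) u hu).trans ?_
            congr 1
            ring
        · by_cases hxr : x = x₁
          · refine .inr ⟨?_, ?_⟩
            · rw [hxr, hrowj.2.2]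
              rfl
            · rw [hrow]
              exact rowOf_snd_of_ne _ (by omega)
          · left
            obtain ⟨u, hu⟩ := Option.ne_none_iff_exists'.1
              (hrowj.1 (x + 1) (by omega) (by omega))
            rw [hu]
            refine (hcont _ (by omega) (by omega) u hu).trans ?_
            congr 1
            ring
  obtain ⟨c, -, hc, -⟩ := key t le_rfl
  simp [hc]

/-- The tag of the cell `x` in a row whose origin is at `0`. -/
def tagAt (l : List Γ) (x : ℤ) : Fin (l.length + 2) :=
  ⟨(max 0 (min ((l.length : ℤ) + 1) (x + 1))).toNat, by omega⟩

/-- As long as the machine runs, a sufficiently wide part of its space-time diagram is a valid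
tiling. -/
theorem exists_isValidTiling (hl : l ≠ []) {N : ℕ} (hN : configAt M l (2 * N + 1) ≠ none) :
    ∃ (P : ℤ → ℤ → Option (DiagramTile Γ Q l)) (B : ℕ),
      IsValidTiling (DiagramConstraint M l) P ∧ IsBoundedTiling B P ∧
        ∀ i j : ℤ, i.natAbs < N → j.natAbs < N → P i j ≠ none := by
  let W : ℕ := 2 * N + l.length + 1
  let P : ℤ → ℤ → Option (DiagramTile Γ Q l) := fun x y =>
    if x.natAbs ≤ W ∧ y.natAbs ≤ N then some (tagAt l x, cellAt M l (y + N).toNat x) else none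
  have hsome : ∀ x y : ℤ, P x y ≠ none ↔ x.natAbs ≤ W ∧ y.natAbs ≤ N := by
    intro x y
    simp only [P]
    split_ifs with h <;> simp [h]
  have hnone : ∀ x y : ℤ, P x y = none ↔ ¬ (x.natAbs ≤ W ∧ y.natAbs ≤ N) := by
    intro x y
    rw [← hsome, not_not]
  have hmem : ∀ x y : ℤ, ∀ t ∈ P x y, x.natAbs ≤ W ∧ y.natAbs ≤ N ∧
      t = (tagAt l x, cellAt M l (y + N).toNat x) := by
    intro x y t ht
    have h := (hsome x y).1 (Option.ne_none_iff_exists'.2 ⟨t, ht⟩)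
    refine ⟨h.1, h.2, ?_⟩
    simp only [P] at ht
    rw [if_pos h] at ht
    exact (Option.some.inj ht).symm
  have hhead : ∀ x y : ℤ, y.natAbs ≤ N → ∀ q ∈ (cellAt M l (y + N).toNat x).2,
      x.natAbs ≤ 2 * N ∧ M q (cellAt M l (y + N).toNat x).1 ≠ none := by
    intro x y hy q hq
    have := cellAt_head (configAt_ne_none_of_le (by omega) hN) hq
    exact ⟨this.1.trans (by omega), this.2⟩
  have htag : ∀ x : ℤ, ((tagAt l x : ℕ) : ℤ) = max 0 (min ((l.length : ℤ) + 1) (x + 1)) :=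
    fun x => Int.toNat_of_nonneg (le_max_left _ _)
  refine ⟨P, W + N, ?_, ?_, ?_⟩
  · intro x y hxy
    constructor
    · simp only [around, ne_eq, hnone]
      omega
    · simp only [around, ne_eq, hnone]
      omega
    · intro t ht h
      obtain ⟨hx, hy, rfl⟩ := hmem _ _ t ht
      have h2 := (hnone _ _).1 h
      have h3 := htag (x + 0)
      show (tagAt l (x + 0) : ℕ) = 0
      omega
    · intro t ht h
      obtain ⟨hx, hy, rfl⟩ := hmem _ _ t ht
      have h2 := (hnone _ _).1 h
      have h3 := htag (x + 0)
      show (tagAt l (x + 0) : ℕ) = _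
      omega
    · intro t ht t' ht'
      obtain ⟨hx, hy, rfl⟩ := hmem _ _ t ht
      obtain ⟨-, -, rfl⟩ := hmem _ _ t' ht'
      have h3 := htag (x + 0)
      have h4 := htag (x + 1)
      show (tagAt l (x + 1) : ℕ) = tagAt l (x + 0) + 1 ∨ ((tagAt l (x + 1) : ℕ) = tagAt l (x + 0) ∧
        ((tagAt l (x + 0) : ℕ) = 0 ∨ (tagAt l (x + 0) : ℕ) = l.length + 1))
      omega
    · intro t ht h
      obtain ⟨hx, hy, rfl⟩ := hmem _ _ t ht
      have h2 := (hnone _ _).1 h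
      have h3 : (y + 0 + N).toNat = 0 := by omega
      simp only [h3]
      exact (initCell_eq_cellAt hl (htag _)).symm
    · intro t ht t' ht'
      obtain ⟨hx, hy, rfl⟩ := hmem _ _ t ht
      obtain ⟨hx', hy', rfl⟩ := hmem _ _ t' ht'
      have e : (y + 0 + N).toNat = (y + -1 + N).toNat + 1 := by omega
      have hcontent : ∀ x' : ℤ, contentOf (P x' (y + -1)) = cellAt M l (y + -1 + N).toNat x' ∨
          (contentOf (P x' (y + -1))).2 = none ∧
            (cellAt M l (y + -1 + N).toNat x').2 = none := by
        intro x'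
        by_cases hx' : x'.natAbs ≤ W
        · left
          simp only [P]
          rw [if_pos ⟨hx', hy'⟩]
          rfl
        · right
          rw [(hnone _ _).2 (by omega)]
          refine ⟨rfl, Option.eq_none_iff_forall_not_mem.2 fun q hq => ?_⟩
          have := (hhead x' (y + -1) hy' q hq).1
          omega
      simp only [around]
      rw [e, cellAt]
      have h1 := hcontent (x + -1)
      have h2 := hcontent (x + 1)
      rw [add_zero, sub_eq_add_neg]
      exact (nextCell_congr M _ h1 h2).symm
    · intro t ht q hq
      obtain ⟨hx, hy, rfl⟩ := hmem _ _ t ht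
      have h := hhead _ _ hy q hq
      refine ⟨(hsome _ _).2 ?_, (hsome _ _).2 ?_, h.2⟩
      · omega
      · omega
  · intro i j h
    have := (hsome i j).1 h
    omega
  · intro i j hi hj
    exact (hsome i j).2 (by omega)

/-- A machine that halts, but only after a long time, gives a sensitive automaton with a small
sensitivity constant. -/
theorem sensitivityConstant_diagram (hl : l ≠ []) {t : ℕ} (ht : configAt M l t = none) {N : ℕ}
    (hN : configAt M l (2 * N + 1) ≠ none) {K : Type} [Nontrivial K] (d : K) :
    (tileAutomaton (DiagramConstraint M l) d).Sensitive ∧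
      (tileAutomaton (DiagramConstraint M l) d).sensitivityConstant ≤ (2 : ℝ)⁻¹ ^ N := by
  have hV := isNearestNeighbor_diagramConstraint M l
  have hF := sensitive_tileAutomaton hV (isDiagonal_diagramConstraint M l) (L := t)
    (fun P ⟨B, hB⟩ hP => by
      by_contra! hcon
      exact configAt_ne_none_of_column hl hP hB (fun j hj hj' => hcon j (by omega)) ht) d
  obtain ⟨P, B, hP, hB, hcov⟩ := exists_isValidTiling hl hN
  exact ⟨hF, sensitivityConstant_tileAutomaton_le hV d hF hP hB hcov⟩

end Diagrams

/-! ### Machines that halt late -/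

section LateHalting

open Turing

section

variable {Γ Q : Type} [Inhabited Γ] [Inhabited Q] {M : TM0.Machine Γ Q} {l : List Γ}

theorem exists_configAt_of_reaches {c : TM0.Cfg Γ Q} (h : TM0.Reaches M (TM0.init l) c) :
    ∃ n, configAt M l n = some c := by
  induction h with
  | refl => exact ⟨0, rfl⟩
  | tail _ hbc ih =>
    obtain ⟨n, hn⟩ := ih
    exact ⟨n + 1, by rw [configAt, hn]; exact hbc⟩

/-- The machine can write at most one cell further to the right per step. -/
theorem tape_nth_eq_default {n : ℕ} {c : TM0.Cfg Γ Q} (h : configAt M l n = some c) {i : ℤ}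
    (hi : (l.length + n : ℤ) ≤ i) : c.Tape.nth i = default := by
  induction n generalizing c i with
  | zero =>
    obtain rfl : TM0.init l = c := Option.some.inj h
    obtain ⟨m, rfl⟩ : ∃ m : ℕ, i = m := ⟨i.toNat, by omega⟩
    show Tape.nth (Tape.mk' _ _) _ = _
    rw [Tape.mk'_nth_nat, ListBlank.nth_mk, List.getI_eq_default]
    omega
  | succ n ih =>
    obtain ⟨⟨q, T⟩, hb, hbc⟩ := Option.bind_eq_some_iff.1 h
    obtain ⟨⟨q', s⟩, -, rfl⟩ := Option.map_eq_some_iff.1 hbc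
    have hT : ∀ {i : ℤ}, (l.length + n : ℤ) ≤ i → T.nth i = default := fun hi => ih hb hi
    rcases s with (_ | _) | s
    · show (T.move .left).nth i = _
      rw [Tape.move_left_nth]
      exact hT (by omega)
    · show (T.move .right).nth i = _
      rw [Tape.move_right_nth]
      exact hT (by omega)
    · show (T.write s).nth i = _
      rw [Tape.write_nth, if_neg (by omega)]
      exact hT (by omega)

/-- A machine with a long output has run for a long time. -/
theorem configAt_ne_none_of_mem_eval {L : ListBlank Γ} (hL : L ∈ TM0.eval M l) {n m : ℕ}
    (hn : L.nth n ≠ default) (hm : l.length + m ≤ n) :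
    configAt M l m ≠ none ∧ ∃ t, configAt M l t = none := by
  obtain ⟨c, hc, rfl⟩ := (Part.mem_map_iff _).1 hL
  obtain ⟨hreach, hhalt⟩ := StateTransition.mem_eval.1 hc
  obtain ⟨t, ht⟩ := exists_configAt_of_reaches hreach
  refine ⟨configAt_ne_none_of_le (n := t) ?_ (by simp [ht]),
    t + 1, by rw [configAt, ht]; exact hhalt⟩
  by_contra hlt
  refine hn ?_
  rw [Tape.right₀_nth]
  exact tape_nth_eq_default ht (by omega)

/-- A machine that uses finitely many states is equivalent to its restriction to them. -/
theorem exists_fintype_machine {Λ : Type} [Inhabited Λ] (M : TM0.Machine Γ Λ) (S : Finset Λ)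
    (hS : TM0.Supports M (S : Set Λ)) :
    ∃ (Q : Type) (_ : Fintype Q) (_ : Inhabited Q) (M' : TM0.Machine Γ Q),
      ∀ l, TM0.eval M' l = TM0.eval M l := by
  let _ : Inhabited S := ⟨⟨default, hS.1⟩⟩
  let M' : TM0.Machine Γ S := fun q a =>
    (M q a).pmap (fun p hp => (⟨p.1, hp⟩, p.2)) fun p hp => hS.2 hp q.2
  let emb : TM0.Cfg Γ S → TM0.Cfg Γ Λ := fun c => ⟨c.q, c.Tape⟩
  have hstep : ∀ c, TM0.step M (emb c) = (TM0.step M' c).map emb := by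
    rintro ⟨q, T⟩
    simp only [TM0.step, M', emb, Option.map_pmap, Option.pmap_eq_map]
  have hresp : StateTransition.Respects (TM0.step M') (TM0.step M) fun a b => emb a = b := by
    rintro a _ rfl
    have ha := hstep a
    cases e : TM0.step M' a with
    | none => simpa [e] using ha
    | some b => exact ⟨_, rfl, Relation.TransGen.single (by simpa [e] using ha)⟩
  refine ⟨S, inferInstance, inferInstance, M', fun l => ?_⟩
  have := StateTransition.tr_eval' _ _ emb hresp (TM0.init l)
  have e : emb (TM0.init l) = TM0.init l := rfl
  rw [TM0.eval, TM0.eval, ← e, this, Part.map_eq_map, Part.map_map]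
  rfl

end

section

open PartrecToTM2

theorem trPosNum_length (n : PosNum) :
    (n : ℕ) < 2 ^ (trPosNum n).length ∧ 2 ^ (trPosNum n).length ≤ 2 * (n : ℕ) := by
  induction n with
  | one => simp [trPosNum]
  | bit0 n ih =>
    simp only [trPosNum, List.length_cons, pow_succ, PosNum.cast_bit0]
    omega
  | bit1 n ih =>
    simp only [trPosNum, List.length_cons, pow_succ, PosNum.cast_bit1]
    omega

theorem trNat_length {n : ℕ} (hn : n ≠ 0) :
    n < 2 ^ (trNat n).length ∧ 2 ^ (trNat n).length ≤ 2 * n := by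
  have h : ((n : Num) : ℕ) = n := Num.to_of_nat n
  rw [trNat]
  cases hN : (n : Num) with
  | zero =>
    rw [hN] at h
    exact absurd h.symm hn
  | pos p =>
    rw [hN] at h
    have hp : (p : ℕ) = n := h
    rw [trNum, ← hp]
    exact trPosNum_length p

theorem trList_length_two_pow (m : ℕ) : (trList [2 ^ m]).length = m + 2 := by
  obtain ⟨h1, h2⟩ := trNat_length (n := 2 ^ m) (by positivity)
  rw [← pow_succ'] at h2
  have h1 := (Nat.pow_lt_pow_iff_right one_lt_two).1 h1
  have h2 := (Nat.pow_le_pow_iff_right one_lt_two).1 h2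
  simp only [trList, List.length_append, List.length_cons, List.length_nil]
  omega

theorem trInit_length {K : Type} [DecidableEq K] {Γ : K → Type} (k : K) (L : List (Γ k)) :
    (TM2to1.trInit k L).length = max 1 L.length := by
  let g : Γ k → TM2to1.Γ' K Γ := fun a => (false, Function.update (fun _ => none) k (some a))
  show (L.reverse.map g).tail.length + 1 = _
  rw [List.length_tail, List.length_map, List.length_reverse]
  omega

/-- The binary numeral of `f k` is computed from that of `k` by a Turing machine with finitely
many states, which leaves as many nonblank cells as there are digits. -/
theorem exists_machine_of_computable {f : ℕ → ℕ} (hf : Computable f) :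
    ∃ (Γ Q : Type) (_ : Fintype Γ) (_ : Fintype Q) (_ : Inhabited Γ) (_ : Inhabited Q)
      (M : TM0.Machine Γ Q), ∀ k, ∃ (l : List Γ) (L : ListBlank Γ),
        l.length = (trList [k]).length ∧ L ∈ TM0.eval M l ∧
          L.nth ((trList [f k]).length - 1) ≠ default := by
  classical
  obtain ⟨c, hc⟩ := ToPartrec.Code.exists_code (Nat.Partrec'.part_iff₁.2 hf.partrec)
  let _ : Inhabited Λ' := ⟨trNormal c Cont'.halt⟩
  let _ : Fintype K' := ⟨{K'.main, K'.rev, K'.aux, K'.stack}, by rintro (_ | _ | _ | _) <;> decide⟩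
  let M₁ := TM2to1.tr (K := K') (Γ := fun _ => Γ') tr
  have hsupp : TM2.Supports tr (codeSupp c Cont'.halt) := tr_supports c Cont'.halt
  obtain ⟨Q, hQ, hQ', M, hM⟩ := exists_fintype_machine (TM1to0.tr M₁) _
    (TM1to0.tr_supports M₁ (TM2to1.tr_supports tr hsupp))
  refine ⟨TM2to1.Γ' K' fun _ => Γ', Q, inferInstance, hQ, inferInstance, hQ', M, fun k => ?_⟩
  have hpos : ∀ n, 0 < (trList [n]).length := fun n => by simp [trList]
  have h2 : trList [f k] ∈ TM2.eval tr K'.main (trList [k]) := by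
    have hinit : (TM2.init K'.main (trList [k]) : TM2.Cfg (fun _ : K' => Γ') Λ' (Option Γ')) =
        init c [k] := by
      rw [TM2.init, init]
      congr 1
      funext s
      cases s <;> rfl
    show _ ∈ (StateTransition.eval (TM2.step tr) (TM2.init K'.main (trList [k]))).map _
    rw [hinit, tr_eval]
    have hck : [f k] ∈ c.eval [k] := by
      have := hc ⟨[k], rfl⟩
      rw [show c.eval [k] = _ from this]
      exact Part.mem_map _ (Part.mem_some (f k))
    exact Part.mem_map _ (Part.mem_map halt hck)
  obtain ⟨L, hL⟩ := Part.dom_iff_mem.1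
    ((TM2to1.tr_eval_dom tr K'.main (trList [k])).2 (Part.dom_iff_mem.2 ⟨_, h2⟩))
  obtain ⟨S, L', rfl, hS, hS'⟩ := TM2to1.tr_eval tr K'.main (trList [k]) hL h2
  refine ⟨TM2to1.trInit K'.main (trList [k]), TM2to1.addBottom L', ?_, ?_, ?_⟩
  · rw [trInit_length]
    exact max_eq_right (hpos k)
  · rw [hM, TM1to0.tr_eval]
    exact hL
  · intro hdef
    have h3 := congrArg (fun a : TM2to1.Γ' K' fun _ => Γ' => a.2 K'.main) hdef
    simp only [TM2to1.addBottom_nth_snd] at h3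
    rw [TM2to1.stk_nth_val _ (hS K'.main), hS'] at h3
    have h4 : (trList [f k]).reverse[(trList [f k]).length - 1]? = none := h3
    rw [List.getElem?_eq_none_iff, List.length_reverse] at h4
    have := hpos (f k)
    omega

end

theorem exists_two_pow_large (C : ℕ) : ∃ s, (s + 4) * C + 2 ≤ 2 ^ s := by
  refine ⟨2 * (2 * C + 5), ?_⟩
  have h : 2 * C + 6 ≤ 2 ^ (2 * C + 5) := Nat.lt_two_pow_self
  calc (2 * (2 * C + 5) + 4) * C + 2 ≤ (2 * C + 6) * (2 * C + 6) := by nlinarith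
    _ ≤ 2 ^ (2 * C + 5) * 2 ^ (2 * C + 5) := Nat.mul_le_mul h h
    _ = 2 ^ (2 * (2 * C + 5)) := by rw [← pow_add, ← two_mul]

/-- No computable function `h` bounds the halting times of machines in terms of a bound `k` on the
number of tiles needed for their space-time diagrams. The machine computes `2 ^ (h k + k)`, whose
numeral takes more than `h k` steps to write; since the machine does not depend on its input `k`,
it suffices that the numeral of `k` is short compared to `k`. -/
theorem exists_late_halting {h : ℕ → ℕ} (hh : Computable h) :
    ∃ (Γ Q : Type) (_ : Fintype Γ) (_ : Fintype Q) (_ : Inhabited Γ) (_ : Inhabited Q)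
      (M : TM0.Machine Γ Q) (l : List Γ) (k : ℕ), l ≠ [] ∧
        Fintype.card (DiagramTile Γ Q l) + 2 ≤ k ∧ configAt M l (h k) ≠ none ∧
          ∃ t, configAt M l t = none := by
  have hf : Computable fun k => 2 ^ (h k + k) := by
    have hpow : Primrec fun n : ℕ => 2 ^ n :=
      (Primrec.nat_rec₁ 1 (Primrec.nat_mul.comp (.const 2) Primrec.snd).to₂).of_eq fun n => by
        induction n with
        | zero => rfl
        | succ n ih => rw [pow_succ', ← ih]
    exact hpow.to_comp.comp (Primrec.nat_add.to_comp.comp hh .id)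
  obtain ⟨Γ, Q, hΓ, hQ, hΓ', hQ', M, hM⟩ := exists_machine_of_computable hf
  obtain ⟨s, hs⟩ := exists_two_pow_large (Fintype.card Γ * (Fintype.card Q + 1))
  obtain ⟨l, L, hl, hL, hout⟩ := hM (2 ^ s)
  rw [trList_length_two_pow] at hl hout
  have hC : 0 < Fintype.card Γ * (Fintype.card Q + 1) :=
    Nat.mul_pos Fintype.card_pos (Nat.succ_pos _)
  have hs' : s + 4 ≤ (s + 4) * (Fintype.card Γ * (Fintype.card Q + 1)) :=
    Nat.le_mul_of_pos_right _ hC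
  obtain ⟨hlong, hhalt⟩ := configAt_ne_none_of_mem_eval hL hout (m := h (2 ^ s)) (by omega)
  refine ⟨Γ, Q, hΓ, hQ, hΓ', hQ', M, l, 2 ^ s, ?_, ?_, hlong, hhalt⟩
  · rintro rfl
    simp at hl
  · simp only [Fintype.card_prod, Fintype.card_fin, Fintype.card_option, hl]
    exact hs

end LateHalting

/-! ### Sensitivity constants are not recursively bounded below -/

theorem inv_two_pow_lt_div {m n : ℕ} (hm : 0 < m) (hn : 0 < n) :
    (2 : ℝ)⁻¹ ^ n < (m : ℝ) / n := by
  have hn' : (0 : ℝ) < n := by exact_mod_cast hn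
  rw [inv_pow, lt_div_iff₀ hn', inv_mul_lt_iff₀ (by positivity)]
  have h1 : (n : ℝ) < 2 ^ n := by exact_mod_cast Nat.lt_two_pow_self
  have h2 : (1 : ℝ) ≤ m := by exact_mod_cast hm
  nlinarith

theorem exists_sensitive_lt {p q : ℕ × ℕ × ℕ → ℕ} (hq : Computable q) (hp₀ : ∀ t, 0 < p t)
    (hq₀ : ∀ t, 0 < q t) :
    ∃ (A : Type) (_ : Fintype A) (_ : Nonempty A) (F : CellularAutomaton 2 A),
      F.Sensitive ∧ F.sensitivityConstant <
        (p (Fintype.card A, F.nbhd.card, F.radius) : ℝ) /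
          (q (Fintype.card A, F.nbhd.card, F.radius) : ℝ) := by
  let s : ℕ × ℕ := (squareNbhd.card, squareNbhd.sup supNorm)
  have hh : Computable fun k => 2 * q (k, s) + 1 :=
    Computable.succ.comp <| (Primrec.nat_mul.comp (.const 2) .id).to_comp.comp <|
      hq.comp <| Computable.pair .id (.const s)
  obtain ⟨Γ, Q, hΓ, hQ, hΓ', hQ', M, l, k, hl, hk, hN, t, ht⟩ := exists_late_halting hh
  obtain ⟨m, rfl⟩ := Nat.exists_eq_add_of_le hk
  -- Superfluous letters bring the number of states to the prescribed value.
  let F := tileAutomaton (DiagramConstraint M l) (0 : Fin (m + 2))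
  obtain ⟨hF, hle⟩ := sensitivityConstant_diagram hl ht hN (0 : Fin (m + 2))
  have hcard : Fintype.card (Fin (m + 2) ⊕ DiagramTile Γ Q l) =
      Fintype.card (DiagramTile Γ Q l) + 2 + m := by
    rw [Fintype.card_sum, Fintype.card_fin]
    omega
  refine ⟨_, inferInstance, inferInstance, F, hF, hle.trans_lt ?_⟩
  rw [hcard]
  exact inv_two_pow_lt_div (hp₀ _) (hq₀ _)

theorem mainTheorem5 :
    (∀ p q : ℕ × ℕ × ℕ → ℕ, Computable p → Computable q →
      (∀ t, 0 < p t) → (∀ t, 0 < q t) →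
      ∃ (A : Type) (_ : Fintype A) (_ : Nonempty A) (F : CellularAutomaton 2 A),
        F.Sensitive ∧
          F.sensitivityConstant <
            (p (Fintype.card A, F.nbhd.card, F.radius) : ℝ) /
              (q (Fintype.card A, F.nbhd.card, F.radius) : ℝ)) ∧
    (∀ (A : Type) [Fintype A] [Nonempty A] (F : CellularAutomaton 1 A),
      F.Sensitive → F.IsSensitivityConstant ((2 : ℝ)⁻¹ ^ (2 * F.radius))) :=
  ⟨fun _ _ _ hq hp₀ hq₀ => exists_sensitive_lt hq hp₀ hq₀,
    fun _ _ _ F hF => F.isSensitivityConstant_of_sensitive hF⟩
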